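/- Let $Y\in\mathbb{R}^{d\times p}$ be a random matrix with independent columns $Y_j\sim\mathcal{N}(\theta^*_{z_j^*},I_d)$, $j\in[p]$, where $\theta_1^*,\dots,\theta_k^*\in\mathbb{R}^d$ and $z^*\in[k]^p$ are deterministic. Let $\Delta_{\min}=\min_{1\le a\ne b\le k}\|\theta_a^*-\theta_b^*\|$ (with $\Delta_{\min}=\infty$ if $k=1$) and $\ell(z,z^*)=\sum_{j=1}^p\|\theta^*_{z_j}-\theta^*_{z^*_j}\|^2$ for $z\in[k]^p$. Spectral initialization: take a singular value decomposition $Y=\sum_{l=1}^{p\wedge d}\hat d_l\hat u_l\hat v_l^T$ with $\hat d_1\ge\dots\ge\hat d_{p\wedge d}\ge 0$ and orthonormal systems $(\hat u_l)$ in $\mathbb{R}^d$ and $(\hat v_l)$ in $\mathbb{R}^p$; put $\hat U=(\hat u_1,\dots,\hat u_k)\in\mathbb{R}^{d\times k}$ (with $\hat u_l=0$ for $l>p\wedge d$) and $\hat\mu=\hat U^TY\in\mathbb{R}^{k\times p}$, with columns $\hat\mu_1,\dots,\hat\mu_p$; for a given $M\ge 0$, let $z^{(0)}\in[k]^p$ be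 any label vector such that, for some $\beta^{(0)}_1,\dots,\beta^{(0)}_k\in\mathbb{R}^k$, $$\sum_{j=1}^p\|\hat\mu_j-\beta^{(0)}_{z^{(0)}_j}\|^2\le M\min_{\beta_1,\dots,\beta_k\in\mathbb{R}^k,\ z\in[k]^p}\ \sum_{j=1}^p\|\hat\mu_j-\beta_{z_j}\|^2 .$$ Proposition. For all $\alpha>0$ and $C'>0$ there is a constant $C>0$, depending only on $\alpha$ and $C'$, with the following property. Consider a sequence of such problems, indexed by $n$, in which $d,p\geq 1$, $k$, $M\ge 0$, $\theta^*$ and $z^*$ may all depend on $n$, such that $$\min_{a\in[k]}\sum_{j=1}^p\mathbf{1}\{z_j^*=a\}\ge\frac{\alpha p}{k}\quad\text{for every } n,\qquad \frac{\Delta_{\min}^2}{(M+1)k^2(1+d/p)}\to\infty\quad\text{as } n\to\infty .$$ Then for all sufficiently large $n$, with probability at least $1-e^{-C'(p+d)}$, every possible output $z^{(0)}$ of the spectral initialization satisfies $$\min_{\pi\in\Pi_k}\ell(\pi\circ z^{(0)},z^*)\le C(M+1)k(p+d),$$ where $\Pi_k$ is the set of permutations of $[k]$ and $(\pi\circ z)_j=\pi(z_j)$.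 -/

import Mathlib

open MeasureTheory ProbabilityTheory Filter Topology

noncomputable section

namespace GaussianClustering

/-- The `j`-th column of a real matrix, as a vector of Euclidean space. -/
def column {m p : ℕ} (A : Matrix (Fin m) (Fin p) ℝ) (j : Fin p) : EuclideanSpace ℝ (Fin m) :=
  WithLp.toLp 2 (fun i => A i j)

/-- The Gaussian mixture model: the columns `Y_1, …, Y_p` of the random `d × p` matrix `Y` are
independent, and `Y_j ∼ N(θ_{z_j}, I_d)`. -/
structure IsGaussianMixture {d p k : ℕ} {Ω : Type*} [MeasurableSpace Ω] (P : Measure Ω)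
    (θ : Fin k → EuclideanSpace ℝ (Fin d)) (z : Fin p → Fin k)
    (Y : Ω → Matrix (Fin d) (Fin p) ℝ) : Prop where
  hasLaw_column : ∀ j, HasLaw (fun ω => column (Y ω) j) (multivariateGaussian (θ (z j)) 1) P
  indep : iIndepFun (fun j ω => column (Y ω) j) P

/-- The number of indices carrying the label `a`. -/
def clusterSize {p k : ℕ} (z : Fin p → Fin k) (a : Fin k) : ℕ :=
  (Finset.univ.filter fun j => z j = a).card

/-- `Δ_min = min_{a ≠ b} ‖θ_a - θ_b‖`; for a single cluster the minimum over the empty set is `∞`. -/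
def minSeparation {d k : ℕ} (θ : Fin k → EuclideanSpace ℝ (Fin d)) : ENNReal :=
  ⨅ (a : Fin k) (b : Fin k) (_ : a ≠ b), ENNReal.ofReal ‖θ a - θ b‖

/-- The loss `ℓ(z, z') = ∑_j ‖θ_{z_j} - θ_{z'_j}‖²`. -/
def loss {d p k : ℕ} (θ : Fin k → EuclideanSpace ℝ (Fin d)) (z z' : Fin p → Fin k) : ℝ :=
  ∑ j, ‖θ (z j) - θ (z' j)‖ ^ 2

/-- `Y = ∑_l σ_l u_l v_lᵀ` is a singular value decomposition of the `d × p` matrix `Y`: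
`l` runs through `min d p` indices, the singular values are non-negative and in non-increasing
order, and the left and the right singular vectors are orthonormal. -/
structure IsSVD {d p : ℕ} (Y : Matrix (Fin d) (Fin p) ℝ) (σ : Fin (min d p) → ℝ)
    (u : Fin (min d p) → EuclideanSpace ℝ (Fin d))
    (v : Fin (min d p) → EuclideanSpace ℝ (Fin p)) : Prop where
  nonneg : ∀ l, 0 ≤ σ l
  antitone : Antitone σ
  left_orthonormal : Orthonormal ℝ u
  right_orthonormal : Orthonormal ℝ v
  eq_sum : Y = ∑ l, σ l • Matrix.vecMulVec (u l) (v l)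

/-- The `d × k` matrix `Û` whose columns are the first `k` left singular vectors. If `k` exceeds
the number `min d p` of available singular vectors, the remaining columns are zero. -/
def leadingLeft {d p : ℕ} (k : ℕ) (u : Fin (min d p) → EuclideanSpace ℝ (Fin d)) :
    Matrix (Fin d) (Fin k) ℝ :=
  Matrix.of fun i l => if h : (l : ℕ) < min d p then u ⟨l, h⟩ i else 0

/-- The `k`-means objective `∑_j ‖μ_j - β_{z_j}‖²` for the columns `μ_j` of a `k × p` matrix. -/
def kmeansObjective {k p : ℕ} (μ : Matrix (Fin k) (Fin p) ℝ)
    (β : Fin k → EuclideanSpace ℝ (Fin k)) (z : Fin p → Fin k) : ℝ :=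
  ∑ j, ‖column μ j - β (z j)‖ ^ 2

/-- `z₀` is a possible output of the spectral initialization with data matrix `Y`: for some
singular value decomposition of `Y` and `μ̂ = Ûᵀ Y`, the labels `z₀`, together with some centers
`β₀`, are an `M`-approximate solution of the `k`-means problem for the columns of `μ̂`. -/
def IsSpectralInit {d p k : ℕ} (M : ℝ) (Y : Matrix (Fin d) (Fin p) ℝ)
    (z₀ : Fin p → Fin k) : Prop :=
  ∃ (σ : Fin (min d p) → ℝ) (u : Fin (min d p) → EuclideanSpace ℝ (Fin d))
    (v : Fin (min d p) → EuclideanSpace ℝ (Fin p)), IsSVD Y σ u v ∧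
    ∃ β₀ : Fin k → EuclideanSpace ℝ (Fin k),
      kmeansObjective ((leadingLeft k u).transpose * Y) β₀ z₀ ≤
        M * ⨅ q : (Fin k → EuclideanSpace ℝ (Fin k)) × (Fin p → Fin k),
          kmeansObjective ((leadingLeft k u).transpose * Y) q.1 q.2

end GaussianClustering

end

/-!
Write `Y = Θ + E`, where the columns of `Θ` are the true centers `θ (z j)` and `E` has independent
standard Gaussian entries.

The only probabilistic input is the operator norm of `E`: by a union bound over norming sets of
`5 ^ d` and `5 ^ p` vectors (`exists_finset_norming`) and the Gaussian tail of each bilinear form,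
`‖E‖ ^ 2 ≤ S` holds outside an event of probability `exp (-C' (p + d))`, where `S` is a multiple of
`p + d` (`IsGaussianMixture.measure_noise_le`). On this event everything is deterministic.

Let `Π = Û Ûᵀ` be the projection onto the leading left singular vectors. Since `Θ` has rank at most
`k`, the singular values of `Y` after the first `k` are at most `‖E‖` (`IsSVD.singularValue_le`), so
`(1 - Π) Θ = (1 - Π) Y - (1 - Π) E` has operator norm at most `2 ‖E‖`. Testing against the normalized
indicators of the clusters, which are `k` orthonormal vectors, gives
`‖(1 - Π) Θ‖_F ^ 2 ≤ 4 k ‖E‖ ^ 2` (`IsSVD.sum_norm_residual_sq_le`). Likewise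
`‖Ûᵀ E‖_F ^ 2 ≤ k ‖E‖ ^ 2`; this controls `Π E`, and it bounds the optimal value of the `k`-means
problem, where the centers `Ûᵀ θ a` compete. Hence the centers `Û β` found by the initialization
satisfy `∑ j, ‖Û β (z₀ j) - θ (z j)‖ ^ 2 ≤ 15 (M + 1) k ‖E‖ ^ 2` (`IsSpectralInit.exists_centers`).

As each cluster has at least `α p / k` members and the true centers are far apart, each of them has
an estimated center much closer to it than half the separation. This matches the labels, and the
total squared error of the estimated centers controls the loss (`exists_perm_loss_le`).
-/

noncomputable section

namespace GaussianClustering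

/-! ### The operator norm of the noise matrix -/

/-- A norming set of at most `5 ^ dim E` vectors. A maximal `1`-separated subset of the ball of
radius `2` has at most `5 ^ dim E` points by comparison of volumes, and it contains a point within
distance `1` of `2 v / ‖v‖`. -/
theorem exists_finset_norming (E : Type*) [NormedAddCommGroup E] [InnerProductSpace ℝ E]
    [FiniteDimensional ℝ E] :
    ∃ N : Finset E, N.card ≤ 5 ^ Module.finrank ℝ E ∧ (∀ c ∈ N, ‖c‖ ≤ 2) ∧
      ∀ v : E, ∃ c ∈ N, ‖v‖ ≤ inner ℝ v c := by
  classical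
  let sep : Finset E → Prop := fun s =>
    (∀ c ∈ s, ‖c‖ ≤ 2) ∧ ∀ c ∈ s, ∀ d ∈ s, c ≠ d → 1 ≤ ‖c - d‖
  have hcard : ∀ s, sep s → s.card ≤ 5 ^ Module.finrank ℝ E := fun s hs =>
    Besicovitch.card_le_of_separated s hs.1 hs.2
  obtain ⟨N, hN, hmax⟩ : ∃ N, sep N ∧ ∀ s, sep s → s.card ≤ N.card := by
    have hfin : (Finset.card '' {s | sep s}).Finite :=
      (Set.finite_Iic (5 ^ Module.finrank ℝ E)).subset (by rintro _ ⟨s, hs, rfl⟩; exact hcard s hs)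
    have hne : (Finset.card '' {s | sep s}).Nonempty := ⟨_, ∅, by simp [sep], rfl⟩
    obtain ⟨_, ⟨N, hN, rfl⟩, h⟩ := hfin.exists_maximal hne
    refine ⟨N, hN, fun s hs => ?_⟩
    by_contra! hlt
    exact absurd (h ⟨s, hs, rfl⟩ hlt.le) (not_le.2 hlt)
  have hcover : ∀ x : E, ‖x‖ ≤ 2 → ∃ c ∈ N, ‖x - c‖ ≤ 1 := by
    intro x hx
    by_contra! hfar
    have hxN : x ∉ N := fun hxN => by simpa using (hfar x hxN).trans' zero_lt_one |>.ne'
    have hsep : sep (insert x N) := by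
      refine ⟨fun c hc => ?_, fun c hc d hd hcd => ?_⟩
      · rcases Finset.mem_insert.1 hc with rfl | hc
        exacts [hx, hN.1 c hc]
      · rcases Finset.mem_insert.1 hc with hcx | hcN <;>
          rcases Finset.mem_insert.1 hd with hdx | hdN
        · exact absurd (hcx.trans hdx.symm) hcd
        · rw [hcx]; exact (hfar d hdN).le
        · rw [hdx, norm_sub_rev]; exact (hfar c hcN).le
        · exact hN.2 c hcN d hdN hcd
    have := hmax _ hsep
    rw [Finset.card_insert_of_notMem hxN] at this
    omega
  refine ⟨N, hcard N hN, hN.1, fun v => ?_⟩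
  rcases eq_or_ne v 0 with rfl | hv
  · obtain ⟨c, hc, -⟩ := hcover 0 (by simp)
    exact ⟨c, hc, by simp⟩
  have hv' : 0 < ‖v‖ := norm_pos_iff.2 hv
  obtain ⟨c, hc, hxc⟩ := hcover ((2 / ‖v‖) • v) (by
    rw [norm_smul, Real.norm_of_nonneg (by positivity)]
    field_simp
    exact le_rfl)
  refine ⟨c, hc, ?_⟩
  have h1 : inner ℝ v ((2 / ‖v‖) • v) = 2 * ‖v‖ := by
    rw [inner_smul_right, real_inner_self_eq_norm_sq]
    field_simp
  have h2 : inner ℝ v ((2 / ‖v‖) • v - c) ≤ ‖v‖ :=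
    (real_inner_le_norm _ _).trans (mul_le_of_le_one_right hv'.le hxc)
  rw [inner_sub_right, h1] at h2
  linarith

/-- For a family of vectors, seen as the columns of a matrix, a bound on the bilinear form over
two norming sets bounds the operator norm. -/
theorem norm_sum_smul_le_of_norming {F : Type*} [NormedAddCommGroup F] [InnerProductSpace ℝ F]
    {p : ℕ} {N : Finset F} {N' : Finset (EuclideanSpace ℝ (Fin p))} {e : Fin p → F} {T : ℝ}
    (hN : ∀ v : F, ∃ c ∈ N, ‖v‖ ≤ inner ℝ v c)
    (hN' : ∀ v : EuclideanSpace ℝ (Fin p), ∃ c ∈ N', ‖v‖ ≤ inner ℝ v c)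
    (h : ∀ x ∈ N, ∀ y ∈ N', ∑ j, y j * inner ℝ x (e j) ≤ T) (y : EuclideanSpace ℝ (Fin p)) :
    ‖∑ j, y j • e j‖ ≤ T * ‖y‖ := by
  obtain ⟨c, hc, hle⟩ := hN (∑ j, y j • e j)
  have hdual : ‖(WithLp.toLp 2 fun j => inner ℝ c (e j) : EuclideanSpace ℝ (Fin p))‖ ≤ T := by
    obtain ⟨y', hy', hle'⟩ := hN' (WithLp.toLp 2 fun j => inner ℝ c (e j))
    refine hle'.trans ((le_of_eq ?_).trans (h c hc y' hy'))
    simp [PiLp.inner_apply]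
  calc ‖∑ j, y j • e j‖ ≤ inner ℝ (∑ j, y j • e j) c := hle
    _ = inner ℝ (WithLp.toLp 2 fun j => inner ℝ c (e j) : EuclideanSpace ℝ (Fin p)) y := by
        simp [PiLp.inner_apply, sum_inner, inner_smul_left, real_inner_comm]
    _ ≤ _ := (real_inner_le_norm _ _).trans (mul_le_mul_of_nonneg_right hdual (norm_nonneg _))

theorem map_inner_multivariateGaussian {d : ℕ} (m x : EuclideanSpace ℝ (Fin d)) :
    (multivariateGaussian m 1).map (fun v => inner ℝ x v) =
      gaussianReal (inner ℝ x m) (‖x‖ ^ 2).toNNReal := by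
  have h := IsGaussian.map_eq_gaussianReal (μ := multivariateGaussian m 1) (innerSL ℝ x)
  have hmean : (multivariateGaussian m 1)[innerSL ℝ x] = inner ℝ x m := by
    rw [ContinuousLinearMap.integral_comp_id_comm IsGaussian.integrable_id]
    simp
  have hvar : Var[innerSL ℝ x; multivariateGaussian m 1] = ‖x‖ ^ 2 := by
    have := covarianceBilin_multivariateGaussian (μ := m) Matrix.PosSemidef.one x x
    rw [covarianceBilin_self IsGaussian.memLp_two_id] at this
    rw [← real_inner_self_eq_norm_sq, PiLp.inner_apply]
    simpa [dotProduct, pow_two] using! this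
  rw [hmean, hvar] at h
  exact h

variable {Ω : Type*} [MeasurableSpace Ω] {P : Measure Ω}

theorem hasSubgaussianMGF_of_hasLaw_gaussianReal {X : Ω → ℝ} {v : NNReal}
    (h : HasLaw X (gaussianReal 0 v) P) : HasSubgaussianMGF X v P := by
  rw [← HasSubgaussianMGF.id_map_iff h.aemeasurable, h.map_eq]
  refine ⟨fun t => integrable_exp_mul_gaussianReal t, fun t => ?_⟩
  rw [mgf_id_gaussianReal]
  simp

/-- The noise part of the `j`-th column in the Gaussian mixture model. -/
def noise {d p k : ℕ} (θ : Fin k → EuclideanSpace ℝ (Fin d)) (z : Fin p → Fin k)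
    (Y : Matrix (Fin d) (Fin p) ℝ) (j : Fin p) : EuclideanSpace ℝ (Fin d) :=
  column Y j - θ (z j)

/-- The Gaussian tail of the bilinear form `xᵀ E y` of the noise matrix `E`, a centered variable of
variance `‖x‖ ^ 2 * ‖y‖ ^ 2 ≤ 16`. -/
theorem IsGaussianMixture.measureReal_le_bilin {d p k : ℕ} {θ : Fin k → EuclideanSpace ℝ (Fin d)}
    {z : Fin p → Fin k} {Y : Ω → Matrix (Fin d) (Fin p) ℝ} (hY : IsGaussianMixture P θ z Y)
    {x : EuclideanSpace ℝ (Fin d)} {y : EuclideanSpace ℝ (Fin p)} (hx : ‖x‖ ≤ 2) (hy : ‖y‖ ≤ 2)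
    {T : ℝ} (hT : 0 ≤ T) :
    P.real {ω | T ≤ ∑ j, y j * inner ℝ x (noise θ z (Y ω) j)} ≤ Real.exp (-T ^ 2 / 32) := by
  have hlaw : ∀ j, HasSubgaussianMGF (fun ω => y j * inner ℝ x (noise θ z (Y ω) j))
      ((y j * ‖x‖) ^ 2).toNNReal P := by
    intro j
    have h1 : HasLaw (fun ω => inner ℝ x (column (Y ω) j))
        (gaussianReal (inner ℝ x (θ (z j))) (‖x‖ ^ 2).toNNReal) P := by
      have hm : AEMeasurable (fun v : EuclideanSpace ℝ (Fin d) => inner ℝ x v)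
          (multivariateGaussian (θ (z j)) 1) := by fun_prop
      exact HasLaw.comp ⟨hm, map_inner_multivariateGaussian _ _⟩ (hY.hasLaw_column j)
    have h2 := (gaussianReal_const_mul (gaussianReal_sub_const h1 (inner ℝ x (θ (z j)))) (y j))
    simp only [sub_self, mul_zero] at h2
    have h3 := hasSubgaussianMGF_of_hasLaw_gaussianReal h2
    simp only [noise, inner_sub_right]
    convert h3 using 1
    ext
    simp [mul_pow, Real.coe_toNNReal _ (mul_nonneg (sq_nonneg (y j)) (sq_nonneg ‖x‖))]
  have hind : iIndepFun (fun j ω => y j * inner ℝ x (noise θ z (Y ω) j)) P :=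
    hY.indep.comp (fun j v => y j * inner ℝ x (v - θ (z j))) fun j => by fun_prop
  have hsum := HasSubgaussianMGF.sum_of_iIndepFun hind (s := Finset.univ) fun j _ => hlaw j
  set c : NNReal := ∑ j, ((y j * ‖x‖) ^ 2).toNNReal
  have hc : (c : ℝ) = ‖y‖ ^ 2 * ‖x‖ ^ 2 := by
    simp_rw [c, NNReal.coe_sum, fun j => Real.coe_toNNReal _ (sq_nonneg (y j * ‖x‖)), mul_pow]
    rw [← Finset.sum_mul, EuclideanSpace.real_norm_sq_eq y]
  have hc16 : (c : ℝ) ≤ 16 := by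
    rw [hc]
    have := mul_le_mul (pow_le_pow_left₀ (norm_nonneg y) hy 2)
      (pow_le_pow_left₀ (norm_nonneg x) hx 2) (by positivity) (by positivity)
    linarith
  -- The Chernoff bound for the variance proxy `16`, which also covers the case `c = 0`.
  have hsum16 : HasSubgaussianMGF (fun ω => ∑ j, y j * inner ℝ x (noise θ z (Y ω) j)) 16 P :=
    ⟨hsum.integrable_exp_mul, fun t => (hsum.mgf_le t).trans (by gcongr; exact hc16)⟩
  refine (hsum16.measure_ge_le hT).trans_eq ?_
  norm_num

/-- With probability at least `1 - exp (-C' (p + d))`, the `d × p` noise matrix has operator norm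
at most `T`, where `T ^ 2` is a multiple of `p + d`. -/
theorem IsGaussianMixture.measure_noise_le {d p k : ℕ} {θ : Fin k → EuclideanSpace ℝ (Fin d)}
    {z : Fin p → Fin k} {Y : Ω → Matrix (Fin d) (Fin p) ℝ} (hY : IsGaussianMixture P θ z Y)
    {C' T : ℝ} (hT : 0 ≤ T) (hTC : 32 * (C' + 2) * ((p : ℝ) + d) ≤ T ^ 2) :
    P {ω | ¬ ∀ y : EuclideanSpace ℝ (Fin p), ‖∑ j, y j • noise θ z (Y ω) j‖ ≤ T * ‖y‖} ≤
      ENNReal.ofReal (Real.exp (-C' * ((p : ℝ) + d))) := by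
  have : IsProbabilityMeasure P := hY.indep.isProbabilityMeasure
  obtain ⟨N, hNc, hN2, hN⟩ := exists_finset_norming (EuclideanSpace ℝ (Fin d))
  obtain ⟨N', hNc', hN2', hN'⟩ := exists_finset_norming (EuclideanSpace ℝ (Fin p))
  rw [finrank_euclideanSpace_fin] at hNc hNc'
  have hsub : {ω | ¬ ∀ y : EuclideanSpace ℝ (Fin p),
        ‖∑ j, y j • noise θ z (Y ω) j‖ ≤ T * ‖y‖} ⊆
      ⋃ q ∈ N ×ˢ N', {ω | T ≤ ∑ j, q.2 j * inner ℝ q.1 (noise θ z (Y ω) j)} := by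
    intro ω hω
    by_contra hcon
    simp only [Set.mem_iUnion, Finset.mem_product, not_exists] at hcon
    exact hω (norm_sum_smul_le_of_norming hN hN' fun x hx y hy =>
      (not_le.1 (hcon (x, y) ⟨hx, hy⟩)).le)
  have hcard : ((N ×ˢ N').card : ℝ) ≤ Real.exp (2 * ((p : ℝ) + d)) := by
    have h5 : (5 : ℝ) ≤ Real.exp 2 := by
      have := Real.quadratic_le_exp_of_nonneg (x := 2) (by norm_num)
      linarith
    calc ((N ×ˢ N').card : ℝ) = (N.card : ℝ) * N'.card := by rw [Finset.card_product]; push_cast; rfl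
      _ ≤ (5 : ℝ) ^ d * 5 ^ p := by gcongr <;> exact_mod_cast ‹_›
      _ = 5 ^ (p + d) := by ring
      _ ≤ Real.exp 2 ^ (p + d) := by gcongr
      _ = _ := by rw [← Real.exp_nat_mul]; push_cast; ring_nf
  refine (measure_mono hsub).trans ((measure_biUnion_finset_le _ _).trans ?_)
  calc ∑ q ∈ N ×ˢ N', P {ω | T ≤ ∑ j, q.2 j * inner ℝ q.1 (noise θ z (Y ω) j)}
      ≤ ∑ q ∈ N ×ˢ N', ENNReal.ofReal (Real.exp (-T ^ 2 / 32)) := by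
        refine Finset.sum_le_sum fun q hq => ?_
        rw [Finset.mem_product] at hq
        rw [← ofReal_measureReal]
        exact ENNReal.ofReal_le_ofReal (hY.measureReal_le_bilin (hN2 _ hq.1) (hN2' _ hq.2) hT)
    _ = ENNReal.ofReal ((N ×ˢ N').card * Real.exp (-T ^ 2 / 32)) := by
        rw [Finset.sum_const, nsmul_eq_mul, ENNReal.ofReal_mul (by positivity),
          ENNReal.ofReal_natCast]
    _ ≤ _ := by
        refine ENNReal.ofReal_le_ofReal ?_
        calc ((N ×ˢ N').card : ℝ) * Real.exp (-T ^ 2 / 32)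
            ≤ Real.exp (2 * ((p : ℝ) + d)) * Real.exp (-T ^ 2 / 32) := by gcongr
          _ = Real.exp (2 * ((p : ℝ) + d) + -T ^ 2 / 32) := (Real.exp_add _ _).symm
          _ ≤ _ := Real.exp_le_exp.2 (by linarith)

/-! ### Orthogonal families and singular value decompositions -/

section Orthogonal

variable {E ι : Type*} [NormedAddCommGroup E] [InnerProductSpace ℝ E] [Fintype ι] {w : ι → E}

theorem norm_sq_sum_smul_of_orthogonal (hw : Pairwise fun i j => inner ℝ (w i) (w j) = 0)
    (b : ι → ℝ) : ‖∑ i, b i • w i‖ ^ 2 = ∑ i, b i ^ 2 * ‖w i‖ ^ 2 := by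
  classical
  rw [← real_inner_self_eq_norm_sq, sum_inner]
  refine Finset.sum_congr rfl fun i _ => ?_
  rw [inner_sum, Finset.sum_eq_single i]
  · rw [inner_smul_left, inner_smul_right, real_inner_self_eq_norm_sq, RCLike.conj_to_real]
    ring
  · intro j _ hj
    rw [inner_smul_left, inner_smul_right, hw hj.symm]
    simp
  · simp

theorem norm_sum_smul_le_of_orthogonal (hw : Pairwise fun i j => inner ℝ (w i) (w j) = 0)
    (hw1 : ∀ i, ‖w i‖ ≤ 1) (b : EuclideanSpace ℝ ι) : ‖∑ i, b i • w i‖ ≤ ‖b‖ := by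
  rw [← sq_le_sq₀ (norm_nonneg _) (norm_nonneg _), norm_sq_sum_smul_of_orthogonal hw,
    EuclideanSpace.real_norm_sq_eq]
  refine Finset.sum_le_sum fun i _ => mul_le_of_le_one_right (sq_nonneg _) ?_
  exact pow_le_one₀ (norm_nonneg _) (hw1 i)

/-- The map `x ↦ x - W Wᵀ x` for the matrix `W` with columns `w i`. For orthogonal vectors of norm
`0` or `1` it is the projection onto the orthogonal complement of their span. -/
def residual (w : ι → E) : E →ₗ[ℝ] E where
  toFun x := x - ∑ i, inner ℝ (w i) x • w i
  map_add' x y := by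
    simp only [inner_add_right, add_smul, Finset.sum_add_distrib]
    abel
  map_smul' r x := by
    simp only [inner_smul_right, mul_smul, Finset.smul_sum, smul_sub, RingHom.id_apply]

theorem residual_apply (w : ι → E) (x : E) : residual w x = x - ∑ i, inner ℝ (w i) x • w i := rfl

theorem norm_residual_le (hw : Pairwise fun i j => inner ℝ (w i) (w j) = 0)
    (hw1 : ∀ i, ‖w i‖ ≤ 1) (x : E) : ‖residual w x‖ ≤ ‖x‖ := by
  have h1 := norm_sum_smul_le_of_orthogonal hw hw1 (WithLp.toLp 2 fun i => inner ℝ (w i) x)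
  rw [← sq_le_sq₀ (norm_nonneg _) (norm_nonneg _), EuclideanSpace.real_norm_sq_eq] at h1
  have h2 : inner ℝ x (∑ i, inner ℝ (w i) x • w i) = ∑ i, inner ℝ (w i) x ^ 2 := by
    rw [inner_sum]
    refine Finset.sum_congr rfl fun i _ => ?_
    rw [inner_smul_right, real_inner_comm, pow_two]
  rw [← sq_le_sq₀ (norm_nonneg _) (norm_nonneg _), residual_apply, norm_sub_sq_real, h2]
  have : (0 : ℝ) ≤ ∑ i, inner ℝ (w i) x ^ 2 := Finset.sum_nonneg fun i _ => sq_nonneg _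
  dsimp only at h1
  linarith

/-- An operator norm bound for the matrix with columns `e j` is also one for its transpose. -/
theorem sum_inner_sq_le {p : ℕ} {e : Fin p → E} {s : ℝ} (hs : 0 ≤ s)
    (h : ∀ y : EuclideanSpace ℝ (Fin p), ‖∑ j, y j • e j‖ ≤ s * ‖y‖) (x : E) :
    ∑ j, inner ℝ x (e j) ^ 2 ≤ s ^ 2 * ‖x‖ ^ 2 := by
  set q : EuclideanSpace ℝ (Fin p) := WithLp.toLp 2 fun j => inner ℝ x (e j) with hq
  have h1 : ‖q‖ ^ 2 = inner ℝ x (∑ j, q j • e j) := by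
    rw [EuclideanSpace.real_norm_sq_eq, inner_sum]
    refine Finset.sum_congr rfl fun j _ => ?_
    rw [inner_smul_right, pow_two]
  have h2 : ‖q‖ ^ 2 ≤ ‖x‖ * (s * ‖q‖) :=
    h1.trans_le ((real_inner_le_norm _ _).trans (by gcongr; exact h q))
  have h3 : ‖q‖ ≤ s * ‖x‖ := by
    rcases (norm_nonneg q).eq_or_lt with h0 | h0
    · rw [← h0]; positivity
    · refine le_of_mul_le_mul_right ?_ h0
      linarith
  have h4 := pow_le_pow_left₀ (norm_nonneg q) h3 2
  rw [EuclideanSpace.real_norm_sq_eq, mul_pow] at h4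
  exact h4

end Orthogonal

variable {d p k : ℕ}

/-- The `l`-th column of `leadingLeft k u`. -/
def leadingVector (k : ℕ) (u : Fin (min d p) → EuclideanSpace ℝ (Fin d)) (l : Fin k) :
    EuclideanSpace ℝ (Fin d) :=
  if h : (l : ℕ) < min d p then u ⟨l, h⟩ else 0

theorem column_leadingLeft_transpose_mul (u : Fin (min d p) → EuclideanSpace ℝ (Fin d))
    (Y : Matrix (Fin d) (Fin p) ℝ) (j : Fin p) :
    column ((leadingLeft k u).transpose * Y) j =
      WithLp.toLp 2 fun l => inner ℝ (leadingVector k u l) (column Y j) := by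
  ext l
  simp only [column, leadingLeft, leadingVector, Matrix.mul_apply, Matrix.transpose_apply,
    Matrix.of_apply, PiLp.inner_apply]
  refine Finset.sum_congr rfl fun i _ => ?_
  split_ifs <;> simp [mul_comm]

theorem pairwise_inner_leadingVector {u : Fin (min d p) → EuclideanSpace ℝ (Fin d)}
    (hu : Orthonormal ℝ u) :
    Pairwise fun l l' : Fin k => inner ℝ (leadingVector k u l) (leadingVector k u l') = 0 := by
  intro l l' hll
  simp only [leadingVector]
  split_ifs <;> try simp
  exact hu.2 fun h => hll (Fin.ext (by simpa using h))

theorem norm_leadingVector_le {u : Fin (min d p) → EuclideanSpace ℝ (Fin d)}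
    (hu : Orthonormal ℝ u) (l : Fin k) : ‖leadingVector k u l‖ ≤ 1 := by
  simp only [leadingVector]
  split_ifs
  · exact (hu.1 _).le
  · simp

/-- The projection onto the span of the leading vectors fixes `u i` for `i < k` and kills the other
singular vectors. -/
theorem sum_inner_leadingVector_smul {u : Fin (min d p) → EuclideanSpace ℝ (Fin d)}
    (hu : Orthonormal ℝ u) (i : Fin (min d p)) :
    ∑ l : Fin k, inner ℝ (leadingVector k u l) (u i) • leadingVector k u l =
      if (i : ℕ) < k then u i else 0 := by
  have horth : ∀ l : Fin k, (l : ℕ) ≠ i → inner ℝ (leadingVector k u l) (u i) = 0 := by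
    intro l hl
    simp only [leadingVector]
    split_ifs
    · exact hu.2 fun h => hl (by rw [← h])
    · simp
  split_ifs with hi
  · rw [Finset.sum_eq_single ⟨i, hi⟩]
    · simp only [leadingVector, dif_pos i.2]
      rw [real_inner_self_eq_norm_sq, hu.1 i, one_pow, one_smul]
    · intro l _ hl
      rw [horth l fun h => hl (Fin.ext h), zero_smul]
    · simp
  · refine Finset.sum_eq_zero fun l _ => ?_
    rw [horth l (by have := l.2; omega), zero_smul]

namespace IsSVD

variable {Y : Matrix (Fin d) (Fin p) ℝ} {σ : Fin (min d p) → ℝ}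
  {u : Fin (min d p) → EuclideanSpace ℝ (Fin d)} {v : Fin (min d p) → EuclideanSpace ℝ (Fin p)}

theorem sum_smul_column (h : IsSVD Y σ u v) (y : EuclideanSpace ℝ (Fin p)) :
    ∑ j, y j • column Y j = ∑ l, (σ l * inner ℝ (v l) y) • u l := by
  ext i
  have hY : ∀ j, Y i j = ∑ l, σ l * (u l i * v l j) := by
    intro j
    conv_lhs => rw [h.eq_sum]
    simp [Matrix.sum_apply, Matrix.vecMulVec_apply]
  simp only [WithLp.ofLp_sum, WithLp.ofLp_smul, Finset.sum_apply, Pi.smul_apply, smul_eq_mul,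
    column, hY, PiLp.inner_apply, Finset.mul_sum, Finset.sum_mul]
  rw [Finset.sum_comm]
  refine Finset.sum_congr rfl fun l _ => Finset.sum_congr rfl fun j _ => ?_
  simp
  ring

/-- Weyl's inequality for a perturbation of a matrix of rank at most `k`: all but the first `k`
singular values are at most the operator norm of the perturbation. A combination `y` of the right
singular vectors `v 0, …, v l` is killed by the low rank part, and `‖Y y‖ ≥ σ l * ‖y‖`. -/
theorem singularValue_le (h : IsSVD Y σ u v) {θ : Fin k → EuclideanSpace ℝ (Fin d)}
    {z : Fin p → Fin k} {s : ℝ} (hs : 0 ≤ s)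
    (hE : ∀ y : EuclideanSpace ℝ (Fin p), ‖∑ j, y j • noise θ z Y j‖ ≤ s * ‖y‖)
    {l : Fin (min d p)} (hl : k ≤ l) : σ l ≤ s := by
  let g : Fin (min d p) → EuclideanSpace ℝ (Fin d) := fun i => ∑ j, v i j • θ (z j)
  have hdep : ¬ LinearIndepOn ℝ g (Finset.Iic l : Set (Fin (min d p))) := by
    intro hli
    have hle : Submodule.span ℝ (Set.range fun i : (Finset.Iic l : Set (Fin (min d p))) => g i) ≤
        Submodule.span ℝ (Set.range θ) := by
      rw [Submodule.span_le]
      rintro _ ⟨i, rfl⟩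
      exact Submodule.sum_mem _ fun j _ =>
        Submodule.smul_mem _ _ (Submodule.subset_span ⟨z j, rfl⟩)
    have h1 := (Submodule.finrank_mono hle).trans (finrank_range_le_card θ)
    rw [finrank_span_eq_card hli] at h1
    simp at h1
    omega
  rw [linearIndepOn_finset_iff] at hdep
  push Not at hdep
  obtain ⟨f, hf0, i₀, hi₀, hfi₀⟩ := hdep
  let c : Fin (min d p) → ℝ := fun i => if i ∈ Finset.Iic l then f i else 0
  have hc0 : ∑ i, c i • g i = 0 := by
    simp only [c, ite_smul, zero_smul, Finset.sum_ite_mem, Finset.univ_inter]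
    exact hf0
  set y : EuclideanSpace ℝ (Fin p) := ∑ i, c i • v i with hy
  have hvy : ∀ i, inner ℝ (v i) y = c i := fun i => h.right_orthonormal.inner_right_fintype c i
  have hy2 : ‖y‖ ^ 2 = ∑ i, c i ^ 2 := by
    rw [hy, norm_sq_sum_smul_of_orthogonal fun i j hij => h.right_orthonormal.2 hij]
    simp [h.right_orthonormal.1]
  have hy_pos : 0 < ‖y‖ := by
    refine norm_pos_iff.2 fun h0 => ?_
    have := hvy i₀
    rw [h0, inner_zero_right] at this
    simp only [c, if_pos hi₀] at this
    exact hfi₀ this.symm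
  have hsig : ∑ j, y j • θ (z j) = 0 := by
    rw [← hc0]
    simp only [hy, g, WithLp.ofLp_sum, Finset.sum_apply, Finset.sum_smul, Finset.smul_sum]
    rw [Finset.sum_comm]
    simp [mul_smul]
  have hYy : ∑ j, y j • noise θ z Y j = ∑ i, (σ i * c i) • u i := by
    simp only [noise, smul_sub, Finset.sum_sub_distrib, hsig, sub_zero, h.sum_smul_column, hvy]
  have hlow : σ l ^ 2 * ‖y‖ ^ 2 ≤ ‖∑ j, y j • noise θ z Y j‖ ^ 2 := by
    rw [hYy, norm_sq_sum_smul_of_orthogonal fun i j hij => h.left_orthonormal.2 hij, hy2,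
      Finset.mul_sum]
    refine Finset.sum_le_sum fun i _ => ?_
    rw [h.left_orthonormal.1 i, one_pow, mul_one, mul_pow]
    by_cases hi : i ≤ l
    · gcongr
      · exact h.nonneg l
      · exact h.antitone hi
    · simp [c, hi]
  have h2 := hlow.trans (pow_le_pow_left₀ (norm_nonneg _) (hE y) 2)
  rw [← mul_pow, sq_le_sq₀ (mul_nonneg (h.nonneg l) hy_pos.le) (by positivity)] at h2
  exact le_of_mul_le_mul_right h2 hy_pos

/-- The residual of `Y` after projection onto the leading left singular vectors has operator norm
at most that of the noise. -/
theorem norm_residual_sum_smul_column_le (h : IsSVD Y σ u v) {θ : Fin k → EuclideanSpace ℝ (Fin d)}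
    {z : Fin p → Fin k} {s : ℝ} (hs : 0 ≤ s)
    (hE : ∀ y : EuclideanSpace ℝ (Fin p), ‖∑ j, y j • noise θ z Y j‖ ≤ s * ‖y‖)
    (y : EuclideanSpace ℝ (Fin p)) :
    ‖residual (leadingVector k u) (∑ j, y j • column Y j)‖ ≤ s * ‖y‖ := by
  have hres : residual (leadingVector k u) (∑ j, y j • column Y j) =
      ∑ i : Fin (min d p), (if (i : ℕ) < k then 0 else σ i * inner ℝ (v i) y) • u i := by
    have hproj : ∑ l : Fin k, inner ℝ (leadingVector k u l)
        (∑ j, y j • column Y j) • leadingVector k u l =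
        ∑ i, (σ i * inner ℝ (v i) y) • (if (i : ℕ) < k then u i else 0) := by
      simp only [h.sum_smul_column, inner_sum, inner_smul_right, Finset.sum_smul, mul_smul]
      rw [Finset.sum_comm]
      refine Finset.sum_congr rfl fun i _ => ?_
      rw [← sum_inner_leadingVector_smul h.left_orthonormal i, Finset.smul_sum, Finset.smul_sum]
    rw [residual_apply, hproj, h.sum_smul_column, ← Finset.sum_sub_distrib]
    refine Finset.sum_congr rfl fun i _ => ?_
    split_ifs <;> simp
  rw [hres, ← sq_le_sq₀ (norm_nonneg _) (by positivity),
    norm_sq_sum_smul_of_orthogonal fun i j hij => h.left_orthonormal.2 hij, mul_pow]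
  have hbessel := h.right_orthonormal.sum_inner_products_le y (s := Finset.univ)
  refine le_trans ?_ (mul_le_mul_of_nonneg_left hbessel (sq_nonneg s))
  rw [Finset.mul_sum]
  refine Finset.sum_le_sum fun i _ => ?_
  rw [h.left_orthonormal.1 i, one_pow, mul_one, Real.norm_eq_abs, sq_abs]
  split_ifs with hi
  · rw [zero_pow two_ne_zero]
    positivity
  · rw [mul_pow]
    gcongr
    · exact h.nonneg i
    · exact h.singularValue_le hs hE (not_lt.1 hi)

end IsSVD

/-! ### The estimated centers are close to the true ones -/

section Estimation

variable {d p k : ℕ}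

theorem norm_sq_indicator_cluster (z : Fin p → Fin k) (a : Fin k) :
    ‖(WithLp.toLp 2 fun j => if z j = a then 1 else 0 : EuclideanSpace ℝ (Fin p))‖ ^ 2 =
      clusterSize z a := by
  rw [EuclideanSpace.real_norm_sq_eq]
  simp [clusterSize]

variable {Y : Matrix (Fin d) (Fin p) ℝ} {σ : Fin (min d p) → ℝ}
  {u : Fin (min d p) → EuclideanSpace ℝ (Fin d)} {v : Fin (min d p) → EuclideanSpace ℝ (Fin p)}
  {θ : Fin k → EuclideanSpace ℝ (Fin d)} {z : Fin p → Fin k} {s : ℝ}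

/-- The part of a center missed by the leading singular vectors, weighted by the size of its
cluster: apply the operator norm bounds for the residuals of `Y` and of the noise to the indicator
vector of the cluster. -/
theorem IsSVD.clusterSize_mul_residual_le (h : IsSVD Y σ u v) (hs : 0 ≤ s)
    (hE : ∀ y : EuclideanSpace ℝ (Fin p), ‖∑ j, y j • noise θ z Y j‖ ≤ s * ‖y‖) (a : Fin k) :
    clusterSize z a * ‖residual (leadingVector k u) (θ a)‖ ^ 2 ≤ 4 * s ^ 2 := by
  set y : EuclideanSpace ℝ (Fin p) := WithLp.toLp 2 fun j => if z j = a then 1 else 0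
  have hy : ‖y‖ ^ 2 = clusterSize z a := norm_sq_indicator_cluster z a
  have hsum : ∑ j, y j • column Y j =
      (clusterSize z a : ℝ) • θ a + ∑ j, y j • noise θ z Y j := by
    have hθ : ∑ j, y j • θ (z j) = (clusterSize z a : ℝ) • θ a := by
      have : ∀ j, y j • θ (z j) = if z j = a then θ a else 0 := by
        intro j
        by_cases hj : z j = a <;> simp [y, hj]
      simp only [this, ← Finset.sum_filter, Finset.sum_const, clusterSize, Nat.cast_smul_eq_nsmul]
    simp only [← hθ, noise, smul_sub, Finset.sum_sub_distrib]
    abel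
  have h1 : (clusterSize z a : ℝ) * ‖residual (leadingVector k u) (θ a)‖ ≤ 2 * s * ‖y‖ := by
    have hR := h.norm_residual_sum_smul_column_le hs hE y
    have hRE := (norm_residual_le (pairwise_inner_leadingVector (k := k) h.left_orthonormal)
      (norm_leadingVector_le h.left_orthonormal) (∑ j, y j • noise θ z Y j)).trans (hE y)
    have heq : (clusterSize z a : ℝ) • residual (leadingVector k u) (θ a) =
        residual (leadingVector k u) (∑ j, y j • column Y j) -
          residual (leadingVector k u) (∑ j, y j • noise θ z Y j) := by
      rw [hsum, map_add, map_smul, add_sub_cancel_right]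
    have := norm_sub_le (residual (leadingVector k u) (∑ j, y j • column Y j))
      (residual (leadingVector k u) (∑ j, y j • noise θ z Y j))
    rw [← heq, norm_smul, Real.norm_of_nonneg (Nat.cast_nonneg _)] at this
    linarith
  rcases (Nat.cast_nonneg (α := ℝ) (clusterSize z a)).eq_or_lt with h0 | h0
  · rw [← h0, zero_mul]
    positivity
  · have h2 := pow_le_pow_left₀ (by positivity) h1 2
    rw [mul_pow, mul_pow, hy] at h2
    refine le_of_mul_le_mul_left ?_ h0
    linarith

theorem IsSVD.sum_norm_residual_sq_le (h : IsSVD Y σ u v) (hs : 0 ≤ s)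
    (hE : ∀ y : EuclideanSpace ℝ (Fin p), ‖∑ j, y j • noise θ z Y j‖ ≤ s * ‖y‖) :
    ∑ j, ‖residual (leadingVector k u) (θ (z j))‖ ^ 2 ≤ 4 * (k * s ^ 2) := by
  rw [← Finset.sum_fiberwise Finset.univ z]
  calc ∑ a, ∑ j with z j = a, ‖residual (leadingVector k u) (θ (z j))‖ ^ 2
      = ∑ a, clusterSize z a * ‖residual (leadingVector k u) (θ a)‖ ^ 2 := by
        refine Finset.sum_congr rfl fun a _ => ?_
        rw [Finset.sum_congr rfl fun j hj => by rw [(Finset.mem_filter.1 hj).2],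
          Finset.sum_const, nsmul_eq_mul, clusterSize]
    _ ≤ ∑ _a : Fin k, 4 * s ^ 2 :=
        Finset.sum_le_sum fun a _ => h.clusterSize_mul_residual_le hs hE a
    _ = _ := by
        rw [Finset.sum_const, Finset.card_univ, Fintype.card_fin, nsmul_eq_mul]
        ring

/-- The squared Frobenius norm of `Ûᵀ E`, for the noise matrix `E`. -/
theorem sum_inner_leadingVector_noise_sq_le (hu : Orthonormal ℝ u) (hs : 0 ≤ s)
    (hE : ∀ y : EuclideanSpace ℝ (Fin p), ‖∑ j, y j • noise θ z Y j‖ ≤ s * ‖y‖) :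
    ∑ j, ‖(WithLp.toLp 2 fun l => inner ℝ (leadingVector k u l) (noise θ z Y j) :
      EuclideanSpace ℝ (Fin k))‖ ^ 2 ≤ k * s ^ 2 := by
  simp only [EuclideanSpace.real_norm_sq_eq]
  rw [Finset.sum_comm]
  calc ∑ l : Fin k, ∑ j, inner ℝ (leadingVector k u l) (noise θ z Y j) ^ 2
      ≤ ∑ _l : Fin k, s ^ 2 := Finset.sum_le_sum fun l _ =>
        (sum_inner_sq_le hs hE _).trans (mul_le_of_le_one_right (sq_nonneg s)
          (pow_le_one₀ (norm_nonneg _) (norm_leadingVector_le hu l)))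
    _ = _ := by rw [Finset.sum_const, Finset.card_univ, Fintype.card_fin, nsmul_eq_mul]

/-- The projected true centers `Ûᵀ θ` compete in the `k`-means problem. -/
theorem iInf_kmeansObjective_le (hu : Orthonormal ℝ u) (hs : 0 ≤ s)
    (hE : ∀ y : EuclideanSpace ℝ (Fin p), ‖∑ j, y j • noise θ z Y j‖ ≤ s * ‖y‖) :
    ⨅ q : (Fin k → EuclideanSpace ℝ (Fin k)) × (Fin p → Fin k),
      kmeansObjective ((leadingLeft k u).transpose * Y) q.1 q.2 ≤ k * s ^ 2 := by
  have hbdd : BddBelow (Set.range fun q : (Fin k → EuclideanSpace ℝ (Fin k)) × (Fin p → Fin k) =>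
      kmeansObjective ((leadingLeft k u).transpose * Y) q.1 q.2) :=
    ⟨0, by rintro _ ⟨q, rfl⟩; exact Finset.sum_nonneg fun _ _ => sq_nonneg _⟩
  refine (ciInf_le hbdd
    (fun a => WithLp.toLp 2 fun l => inner ℝ (leadingVector k u l) (θ a), z)).trans
    ((le_of_eq ?_).trans (sum_inner_leadingVector_noise_sq_le hu hs hE))
  refine Finset.sum_congr rfl fun j _ => ?_
  rw [column_leadingLeft_transpose_mul, ← WithLp.toLp_sub]
  congr 3
  ext l
  simp [noise, inner_sub_right]

/-- On the event that the noise has operator norm at most `s`, the centers `Û β` estimated by the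
spectral initialization are close, on average over `j`, to the true centers. -/
theorem IsSpectralInit.exists_centers {M : ℝ} (hM : 0 ≤ M) {z₀ : Fin p → Fin k}
    (h : IsSpectralInit M Y z₀) (hs : 0 ≤ s)
    (hE : ∀ y : EuclideanSpace ℝ (Fin p), ‖∑ j, y j • noise θ z Y j‖ ≤ s * ‖y‖) :
    ∃ c : Fin k → EuclideanSpace ℝ (Fin d),
      ∑ j, ‖c (z₀ j) - θ (z j)‖ ^ 2 ≤ 15 * ((M + 1) * k * s ^ 2) := by
  obtain ⟨σ, u, v, hsvd, β, hβ⟩ := h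
  have hu := hsvd.left_orthonormal
  set w : Fin k → EuclideanSpace ℝ (Fin d) := leadingVector k u
  have hw := pairwise_inner_leadingVector (k := k) hu
  have hw1 := norm_leadingVector_le (k := k) hu
  let coef : EuclideanSpace ℝ (Fin d) → EuclideanSpace ℝ (Fin k) := fun x =>
    WithLp.toLp 2 fun l => inner ℝ (w l) x
  refine ⟨fun a => ∑ l, β a l • w l, ?_⟩
  have hobj : ∑ j, ‖β (z₀ j) - coef (column Y j)‖ ^ 2 ≤ M * (k * s ^ 2) := by
    refine (le_of_eq ?_).trans
      (hβ.trans (mul_le_mul_of_nonneg_left (iInf_kmeansObjective_le hu hs hE) hM))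
    refine Finset.sum_congr rfl fun j _ => ?_
    rw [column_leadingLeft_transpose_mul, norm_sub_rev]
  have hpt : ∀ j, ‖∑ l, β (z₀ j) l • w l - θ (z j)‖ ^ 2 ≤
      3 * (‖β (z₀ j) - coef (column Y j)‖ ^ 2 + ‖coef (noise θ z Y j)‖ ^ 2 +
        ‖residual w (θ (z j))‖ ^ 2) := by
    intro j
    have hdec : ∑ l, β (z₀ j) l • w l - θ (z j) =
        ∑ l, (β (z₀ j) - coef (column Y j)) l • w l + ∑ l, coef (noise θ z Y j) l • w l -
          residual w (θ (z j)) := by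
      simp only [coef, noise, residual_apply, PiLp.sub_apply, sub_smul, inner_sub_right,
        Finset.sum_sub_distrib]
      abel
    have h1 := norm_sum_smul_le_of_orthogonal hw hw1 (β (z₀ j) - coef (column Y j))
    have h2 := norm_sum_smul_le_of_orthogonal hw hw1 (coef (noise θ z Y j))
    have h3 : ‖∑ l, β (z₀ j) l • w l - θ (z j)‖ ≤
        ‖β (z₀ j) - coef (column Y j)‖ + ‖coef (noise θ z Y j)‖ + ‖residual w (θ (z j))‖ := by
      rw [hdec]
      exact (norm_sub_le _ _).trans (add_le_add_left ((norm_add_le _ _).trans (add_le_add h1 h2)) _)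
    refine (pow_le_pow_left₀ (norm_nonneg _) h3 2).trans ?_
    linarith [sq_nonneg (‖β (z₀ j) - coef (column Y j)‖ - ‖coef (noise θ z Y j)‖),
      sq_nonneg (‖β (z₀ j) - coef (column Y j)‖ - ‖residual w (θ (z j))‖),
      sq_nonneg (‖coef (noise θ z Y j)‖ - ‖residual w (θ (z j))‖)]
  refine (Finset.sum_le_sum fun j _ => hpt j).trans ?_
  rw [← Finset.mul_sum, Finset.sum_add_distrib, Finset.sum_add_distrib]
  have h2 : ∑ j, ‖coef (noise θ z Y j)‖ ^ 2 ≤ k * s ^ 2 :=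
    sum_inner_leadingVector_noise_sq_le hu hs hE
  have h3 := hsvd.sum_norm_residual_sq_le hs hE
  have h4 : 0 ≤ M * (k * s ^ 2) := by positivity
  linarith

end Estimation

/-! ### From close centers to a matching of the labels -/

/-- If the centers `c` fit the true ones with total squared error at most `B`, and `B` is small
compared with the cluster sizes and the separation `D`, then every true center `θ a` has some `c b`
within `D / 4`, where `b` is a label in use on the cluster `a`. By separation `a ↦ b` is injective,
hence a permutation, and a sample still labelled wrongly after undoing it has a squared error of at
least half its loss. -/
theorem exists_perm_loss_le {d p k : ℕ} {θ c : Fin k → EuclideanSpace ℝ (Fin d)}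
    {z z₀ : Fin p → Fin k} {B D : ℝ} (hB : ∑ j, ‖c (z₀ j) - θ (z j)‖ ^ 2 ≤ B) (hD : 0 < D)
    (hsep : ∀ a b, a ≠ b → D ≤ ‖θ a - θ b‖) (hpos : ∀ a, 0 < clusterSize z a)
    (hsize : ∀ a, 16 * B ≤ clusterSize z a * D ^ 2) :
    ∃ π : Equiv.Perm (Fin k), loss θ (π ∘ z₀) z ≤ 2 * B := by
  have hex : ∀ a, ∃ j, z j = a ∧ ‖c (z₀ j) - θ a‖ ≤ D / 4 := by
    intro a
    have hpos' : (0 : ℝ) < clusterSize z a := by exact_mod_cast hpos a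
    by_contra! hcon
    have h1 : ∑ j : Fin p with z j = a, (D / 4) ^ 2 <
        ∑ j with z j = a, ‖c (z₀ j) - θ (z j)‖ ^ 2 := by
      refine Finset.sum_lt_sum_of_nonempty (Finset.card_pos.1 (hpos a)) fun j hj => ?_
      have hj' := (Finset.mem_filter.1 hj).2
      rw [hj']
      exact pow_lt_pow_left₀ (hcon j hj') (by positivity) two_ne_zero
    have h2 : ∑ j with z j = a, ‖c (z₀ j) - θ (z j)‖ ^ 2 ≤ ∑ j, ‖c (z₀ j) - θ (z j)‖ ^ 2 :=
      Finset.sum_le_sum_of_subset_of_nonneg (Finset.filter_subset _ _) fun _ _ _ => sq_nonneg _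
    rw [Finset.sum_const, nsmul_eq_mul] at h1
    have h3 := hsize a
    rw [clusterSize] at h3
    linarith
  choose J hJz hJ using hex
  have hinj : Function.Injective fun a => z₀ (J a) := by
    intro a b hab
    by_contra hne
    have h1 := hsep a b hne
    have h2 := hJ b
    simp only at hab
    rw [← hab] at h2
    have h3 := norm_sub_le_norm_sub_add_norm_sub (θ a) (c (z₀ (J a))) (θ b)
    rw [norm_sub_rev (θ a) (c _)] at h3
    linarith [hJ a]
  let e := Equiv.ofBijective _ (Finite.injective_iff_bijective.1 hinj)
  refine ⟨e.symm, ?_⟩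
  have hpt : ∀ j, ‖θ (e.symm (z₀ j)) - θ (z j)‖ ^ 2 ≤ 2 * ‖c (z₀ j) - θ (z j)‖ ^ 2 := by
    intro j
    have hJj : ‖c (z₀ j) - θ (e.symm (z₀ j))‖ ≤ D / 4 := by
      have h1 := hJ (e.symm (z₀ j))
      rwa [show z₀ (J (e.symm (z₀ j))) = z₀ j from e.apply_symm_apply (z₀ j)] at h1
    by_cases hj : e.symm (z₀ j) = z j
    · rw [hj, sub_self, norm_zero, zero_pow two_ne_zero]
      positivity
    · have h1 := hsep _ _ hj
      have h2 := norm_sub_le_norm_sub_add_norm_sub (θ (e.symm (z₀ j))) (c (z₀ j)) (θ (z j))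
      rw [norm_sub_rev (θ _) (c _)] at h2
      have h3 : ‖θ (e.symm (z₀ j)) - θ (z j)‖ ≤ 4 / 3 * ‖c (z₀ j) - θ (z j)‖ := by linarith
      have h4 := pow_le_pow_left₀ (norm_nonneg _) h3 2
      linarith [sq_nonneg ‖c (z₀ j) - θ (z j)‖, mul_pow (4 / 3) ‖c (z₀ j) - θ (z j)‖ 2]
  calc loss θ (e.symm ∘ z₀) z ≤ ∑ j, 2 * ‖c (z₀ j) - θ (z j)‖ ^ 2 :=
        Finset.sum_le_sum fun j _ => hpt j
    _ ≤ _ := by rw [← Finset.mul_sum]; linarith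

/-- The hypothesis on the minimal separation, as inequalities between real numbers; there are none
of them for a single cluster. -/
theorem le_norm_sub_sq_of_le_minSeparation {d k : ℕ} {θ : Fin k → EuclideanSpace ℝ (Fin d)}
    {r x : ℝ} (hr : 0 ≤ r)
    (h : ENNReal.ofReal r ≤ minSeparation θ ^ 2 / ENNReal.ofReal x) {a b : Fin k} (hab : a ≠ b) :
    r * x ≤ ‖θ a - θ b‖ ^ 2 := by
  have h1 : minSeparation θ ≤ ENNReal.ofReal ‖θ a - θ b‖ :=
    iInf_le_of_le a (iInf_le_of_le b (iInf_le_of_le hab le_rfl))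
  have h2 := (ENNReal.mul_le_of_le_div h).trans (pow_le_pow_left' h1 2)
  rw [← ENNReal.ofReal_mul hr, ← ENNReal.ofReal_pow (norm_nonneg _)] at h2
  exact (ENNReal.ofReal_le_ofReal_iff (sq_nonneg _)).1 h2

end GaussianClustering

end

/-! ### The loss of the spectral initialization -/

/-- Spectral initialization for a Gaussian mixture. The asymptotic condition refers to a sequence
of problems indexed by `n`, in which all quantities but `α` and `C'` may vary; the constant `C` is
chosen before the sequence. The probability bound says that the event that some output `z₀` of the
initialization violates the loss bound has (outer) probability at most `exp (-C' (p + d))`. -/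
theorem proposition1 (α C' : ℝ) (hα : 0 < α) (hC' : 0 < C') :
    ∃ C : ℝ, 0 < C ∧
      ∀ (d p k : ℕ → ℕ) (_ : ∀ n, 0 < d n) (_ : ∀ n, 0 < p n)
        (M : ℕ → ℝ) (_ : ∀ n, 0 ≤ M n)
        (Ω : ℕ → Type*) [∀ n, MeasurableSpace (Ω n)]
        (P : ∀ n, Measure (Ω n)) [∀ n, IsProbabilityMeasure (P n)]
        (θ : ∀ n, Fin (k n) → EuclideanSpace ℝ (Fin (d n)))
        (zstar : ∀ n, Fin (p n) → Fin (k n))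
        (Y : ∀ n, Ω n → Matrix (Fin (d n)) (Fin (p n)) ℝ),
        (∀ n, GaussianClustering.IsGaussianMixture (P n) (θ n) (zstar n) (Y n)) →
        (∀ n (a : Fin (k n)),
          α * (p n : ℝ) / (k n : ℝ) ≤ (GaussianClustering.clusterSize (zstar n) a : ℝ)) →
        Tendsto (fun n => GaussianClustering.minSeparation (θ n) ^ 2 /
            ENNReal.ofReal ((M n + 1) * (k n : ℝ) ^ 2 * (1 + (d n : ℝ) / (p n : ℝ))))
          atTop (𝓝 ⊤) →
        ∀ᶠ n in atTop,
          P n {ω | ¬ ∀ z₀ : Fin (p n) → Fin (k n),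
              GaussianClustering.IsSpectralInit (M n) (Y n ω) z₀ →
              (⨅ π : Equiv.Perm (Fin (k n)),
                GaussianClustering.loss (θ n) (π ∘ z₀) (zstar n)) ≤
                C * (M n + 1) * (k n : ℝ) * ((p n : ℝ) + (d n : ℝ))}
            ≤ ENNReal.ofReal (Real.exp (-C' * ((p n : ℝ) + (d n : ℝ)))) := by
  refine ⟨960 * (C' + 2), by positivity, ?_⟩
  intro d p k hd hp M hM Ω _ P _ θ zstar Y hY hsize hlim
  -- `K` is chosen so that `16 * 15 * (M + 1) * k * S ≤ (α * p / k) * D ^ 2`, with equality, for the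
  -- squared separation `D ^ 2 = K * (M + 1) * k ^ 2 * (1 + d / p)` and the bound `S` on the squared
  -- operator norm of the noise.
  set K : ℝ := 7680 * (C' + 2) / α with hK
  have hKpos : 0 < K := by positivity
  filter_upwards [hlim.eventually_const_lt (ENNReal.ofReal_lt_top (r := K))] with n hn
  have hp' : (0 : ℝ) < p n := by exact_mod_cast hp n
  have hd' : (0 : ℝ) < d n := by exact_mod_cast hd n
  -- The label of a sample witnesses `0 < k`.
  have hk' : (0 : ℝ) < k n := by exact_mod_cast (zstar n ⟨0, hp n⟩).pos
  have hM' : 0 < M n + 1 := by linarith [hM n]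
  have hx : 0 < (M n + 1) * (k n : ℝ) ^ 2 * (1 + (d n : ℝ) / (p n : ℝ)) := by positivity
  set S : ℝ := 32 * (C' + 2) * ((p n : ℝ) + d n) with hS
  have hSpos : 0 < S := by positivity
  refine (measure_mono fun ω hω => ?_).trans ((hY n).measure_noise_le (T := √S) (C' := C')
    (Real.sqrt_nonneg _) (Real.sq_sqrt hSpos.le).ge)
  refine fun hE => hω fun z₀ hz₀ => ?_
  obtain ⟨c, hc⟩ := hz₀.exists_centers (hM n) (Real.sqrt_nonneg _) hE
  rw [Real.sq_sqrt hSpos.le] at hc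
  obtain ⟨π, hπ⟩ := GaussianClustering.exists_perm_loss_le hc
    (Real.sqrt_pos.2 (mul_pos hKpos hx))
    (fun a b hab => (Real.sqrt_le_left (norm_nonneg _)).2
      (GaussianClustering.le_norm_sub_sq_of_le_minSeparation hKpos.le hn.le hab))
    (fun a => by
      have : (0 : ℝ) < GaussianClustering.clusterSize (zstar n) a :=
        (hsize n a).trans_lt' (by positivity)
      exact_mod_cast this)
    (fun a => by
      rw [Real.sq_sqrt (mul_pos hKpos hx).le]
      refine le_trans (le_of_eq ?_) (mul_le_mul_of_nonneg_right (hsize n a)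
        (mul_pos hKpos hx).le)
      rw [hK, hS]
      field_simp
      ring)
  refine (ciInf_le (Set.finite_range _).bddBelow π).trans (hπ.trans (le_of_eq ?_))
  rw [hS]
  ring
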